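/- Let $X$ be a Hausdorff space that is zero-dimensional, i.e. the clopen sets form a base for its topology. Let $C_c(X)$ be the ring of all continuous functions $f:X\to\mathbb{R}$ with countable range $f(X)$. The $m_c$-topology on $C_c(X)$ is the topology having as an open base the sets $$M(g,u)=\{f\in C_c(X): |f(x)-g(x)|<u(x)\text{ for each }x\in X\},$$ where $g\in C_c(X)$ and $u$ is a positive unit of $C_c(X)$ (a unit with $u(x)>0$ for all $x\in X$). Then $X$ is a $P$-space (every $G_\delta$-subset of $X$ is open) if and only if every proper ideal of $C_c(X)$ is closed in the $m_c$-topology. -/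

import Mathlib

/-- A `P`-space: every `Gδ` subset is open. (Separation axioms are assumed separately.) -/
def IsPSpace (X : Type*) [TopologicalSpace X] : Prop :=
  ∀ s : Set X, IsGδ s → IsOpen s

/-- A zero-dimensional space: the clopen subsets form a base of the topology. -/
def IsZeroDimensional (X : Type*) [TopologicalSpace X] : Prop :=
  TopologicalSpace.IsTopologicalBasis {s : Set X | IsClopen s}

/-- `C_c(X)`: the subring of `C(X, ℝ)` of all functions with countable range. -/
def Cc (X : Type*) [TopologicalSpace X] : Subring C(X, ℝ) where
  carrier := {f | (Set.range f).Countable}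
  mul_mem' {f g} hf hg := by
    refine (Set.Countable.image2 hf hg (fun a b => a * b)).mono ?_
    rintro _ ⟨x, rfl⟩
    exact ⟨f x, ⟨x, rfl⟩, g x, ⟨x, rfl⟩, rfl⟩
  add_mem' {f g} hf hg := by
    refine (Set.Countable.image2 hf hg (fun a b => a + b)).mono ?_
    rintro _ ⟨x, rfl⟩
    exact ⟨f x, ⟨x, rfl⟩, g x, ⟨x, rfl⟩, rfl⟩
  one_mem' := by
    refine (Set.countable_singleton (1 : ℝ)).mono ?_
    rintro _ ⟨x, rfl⟩
    rfl
  zero_mem' := by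
    refine (Set.countable_singleton (0 : ℝ)).mono ?_
    rintro _ ⟨x, rfl⟩
    rfl
  neg_mem' {f} hf := by
    refine (Set.Countable.image hf (fun a => -a)).mono ?_
    rintro _ ⟨x, rfl⟩
    exact ⟨f x, ⟨x, rfl⟩, rfl⟩

/-- A positive unit of the ring `C_c(X)`. -/
def Cc.IsPosUnit {X : Type*} [TopologicalSpace X] (u : Cc X) : Prop :=
  IsUnit u ∧ ∀ x, 0 < u.1 x

/-- `M(g, u) = {f ∈ C_c(X) : |f(x) - g(x)| < u(x) for each x ∈ X}`. -/
def Cc.nbhd {X : Type*} [TopologicalSpace X] (g u : Cc X) : Set (Cc X) :=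
  {f | ∀ x, |f.1 x - g.1 x| < u.1 x}

/-- The base of the `m_c`-topology: all `M(g, u)` with `g ∈ C_c(X)` and `u` a positive unit. -/
def Cc.basicSets (X : Type*) [TopologicalSpace X] : Set (Set (Cc X)) :=
  {s | ∃ g u : Cc X, Cc.IsPosUnit u ∧ s = Cc.nbhd g u}

/-- The `m_c`-topology on `C_c(X)`. It is not an instance, because `C_c(X)`
already carries the topology inherited from the compact-open topology of `C(X, ℝ)`. -/
abbrev mcTopology (X : Type*) [TopologicalSpace X] : TopologicalSpace (Cc X) :=
  TopologicalSpace.generateFrom (Cc.basicSets X)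

/-! In a `P`-space the zero set of `f` is clopen. If `h` is within `|f| / 2` of `f` off that set,
then `h` has no zeros there, so `f` is a multiple of `h`; thus `f ∉ I` forces `h ∉ I`, and every
ideal is closed. Conversely, only the ideals `germIdeal x` are needed. Every `f` with `f x = 0` lies
in the closure of `germIdeal x`, so closedness makes `f` vanish near `x`. Zero-dimensionality places
the zero set of such an `f` inside any given `Gδ` set containing `x`, which is therefore a
neighbourhood of `x`. -/

namespace Cc

variable {X : Type*} [TopologicalSpace X]

/-- The function in `C_c(X)` equal to `f` on the clopen set `s` and to `g` off it. -/
noncomputable def piecewise {s : Set X} (hs : IsClopen s) (f g : Cc X) : Cc X := by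
  classical
  exact ⟨⟨s.piecewise f.1 g.1, Continuous.piecewise (by simp [hs.frontier_eq])
      f.1.continuous g.1.continuous⟩, by
    refine (Set.Countable.union f.2 g.2).mono ?_
    rintro _ ⟨x, rfl⟩
    by_cases hx : x ∈ s
    · exact Or.inl ⟨x, by simp [hx]⟩
    · exact Or.inr ⟨x, by simp [hx]⟩⟩

theorem piecewise_apply_of_mem {s : Set X} (hs : IsClopen s) (f g : Cc X) {x : X} (hx : x ∈ s) :
    (piecewise hs f g).1 x = f.1 x := by
  simp [piecewise, hx]

theorem piecewise_apply_of_notMem {s : Set X} (hs : IsClopen s) (f g : Cc X) {x : X}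
    (hx : x ∉ s) : (piecewise hs f g).1 x = g.1 x := by
  simp [piecewise, hx]

/-- Postcomposition of a function in `C_c(X)` with a continuous real function. -/
def comp (φ : C(ℝ, ℝ)) (f : Cc X) : Cc X :=
  ⟨φ.comp f.1, by
    refine (Set.Countable.image f.2 φ).mono ?_
    rintro _ ⟨x, rfl⟩
    exact ⟨f.1 x, ⟨x, rfl⟩, rfl⟩⟩

/-- The absolute value of a function in `C_c(X)`. -/
def abs (f : Cc X) : Cc X := comp ⟨fun t => |t|, continuous_abs⟩ f

@[simp] theorem abs_apply (f : Cc X) (x : X) : (abs f).1 x = |f.1 x| := rfl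

/-- Half of a function in `C_c(X)`. -/
noncomputable def half (f : Cc X) : Cc X := comp ⟨fun t => t / 2, by fun_prop⟩ f

@[simp] theorem half_apply (f : Cc X) (x : X) : (half f).1 x = f.1 x / 2 := rfl

/-- The pointwise minimum of two functions in `C_c(X)`. -/
noncomputable def min (f g : Cc X) : Cc X :=
  ⟨f.1 ⊓ g.1, by
    refine (Set.Countable.image2 f.2 g.2 (fun a b => a ⊓ b)).mono ?_
    rintro _ ⟨x, rfl⟩
    exact ⟨f.1 x, ⟨x, rfl⟩, g.1 x, ⟨x, rfl⟩, rfl⟩⟩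

@[simp] theorem min_apply (f g : Cc X) (x : X) :
    (min f g).1 x = Min.min (f.1 x) (g.1 x) := rfl

/-- The pointwise inverse of a nowhere vanishing function in `C_c(X)`. -/
noncomputable def inv (f : Cc X) (hf : ∀ x, f.1 x ≠ 0) : Cc X :=
  ⟨⟨fun x => (f.1 x)⁻¹, f.1.continuous.inv₀ hf⟩, by
    refine (Set.Countable.image f.2 (fun a => a⁻¹)).mono ?_
    rintro _ ⟨x, rfl⟩
    exact ⟨f.1 x, ⟨x, rfl⟩, rfl⟩⟩

@[simp] theorem inv_apply (f : Cc X) (hf : ∀ x, f.1 x ≠ 0) (x : X) :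
    (inv f hf).1 x = (f.1 x)⁻¹ := rfl

@[ext] theorem ext {f g : Cc X} (h : ∀ x, f.1 x = g.1 x) : f = g :=
  Subtype.ext (ContinuousMap.ext h)

@[simp] theorem mul_apply (f g : Cc X) (x : X) : (f * g).1 x = f.1 x * g.1 x := rfl

@[simp] theorem sub_apply (f g : Cc X) (x : X) : (f - g).1 x = f.1 x - g.1 x := rfl

@[simp] theorem add_apply (f g : Cc X) (x : X) : (f + g).1 x = f.1 x + g.1 x := rfl

@[simp] theorem one_apply (x : X) : (1 : Cc X).1 x = 1 := rfl

@[simp] theorem zero_apply (x : X) : (0 : Cc X).1 x = 0 := rfl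

theorem isPosUnit_of_pos {u : Cc X} (hu : ∀ x, 0 < u.1 x) : IsPosUnit u := by
  refine ⟨IsUnit.of_mul_eq_one (inv u fun x => (hu x).ne') ?_, hu⟩
  ext x
  simp [(hu x).ne']

theorem mem_nbhd_self {f u : Cc X} (hu : IsPosUnit u) : f ∈ nbhd f u := fun x => by
  simpa using hu.2 x

theorem isOpen_nbhd (f : Cc X) {u : Cc X} (hu : IsPosUnit u) :
    @IsOpen (Cc X) (mcTopology X) (nbhd f u) :=
  TopologicalSpace.isOpen_generateFrom_of_mem ⟨f, u, hu, rfl⟩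

/-- `mcTopology` is only generated by the sets `nbhd g u`; this shows that they form a base and can
be recentred at any of their points. -/
theorem exists_nbhd_subset_of_isOpen {s : Set (Cc X)} (hs : @IsOpen (Cc X) (mcTopology X) s)
    {f : Cc X} (hf : f ∈ s) : ∃ u, IsPosUnit u ∧ nbhd f u ⊆ s := by
  induction (hs : TopologicalSpace.GenerateOpen (basicSets X) s) generalizing f with
  | basic s hs =>
    obtain ⟨g, v, hv, rfl⟩ := hs
    refine ⟨v - abs (f - g), isPosUnit_of_pos fun x => by simpa using hf x, fun h hh x => ?_⟩
    have h₁ := hh x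
    have h₂ := abs_sub_le (h.1 x) (f.1 x) (g.1 x)
    simp only [sub_apply, abs_apply] at h₁
    linarith
  | univ => exact ⟨1, isPosUnit_of_pos fun x => by simp, Set.subset_univ _⟩
  | inter s t hs ht ihs iht =>
    obtain ⟨u, hu, hus⟩ := ihs hf.1
    obtain ⟨v, hv, hvt⟩ := iht hf.2
    refine ⟨min u v, isPosUnit_of_pos fun x => lt_min (hu.2 x) (hv.2 x), fun h hh => ?_⟩
    exact ⟨hus fun x => (hh x).trans_le (min_le_left _ _),
      hvt fun x => (hh x).trans_le (min_le_right _ _)⟩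
  | sUnion S hS ih =>
    obtain ⟨t, ht, hft⟩ := hf
    obtain ⟨u, hu, hut⟩ := ih t ht hft
    exact ⟨u, hu, hut.trans (Set.subset_sUnion_of_mem ht)⟩

theorem isClosed_ideal_of_isPSpace (hP : IsPSpace X) (I : Ideal (Cc X)) :
    @IsClosed (Cc X) (mcTopology X) (I : Set (Cc X)) := by
  let := mcTopology X
  refine ⟨isOpen_iff_forall_mem_open.2 fun f hf => ?_⟩
  have hZ : IsClopen {x | f.1 x = 0} :=
    ⟨isClosed_eq f.1.continuous continuous_const,
      hP _ ((IsGδ.singleton (0 : ℝ)).preimage f.1.continuous)⟩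
  -- The value `1` on the zero set only keeps the radius positive there.
  have hu : IsPosUnit (piecewise hZ 1 (half (abs f))) := isPosUnit_of_pos fun x => by
    by_cases hx : f.1 x = 0
    · simp [piecewise_apply_of_mem hZ _ _ hx]
    · rw [piecewise_apply_of_notMem hZ _ _ hx]
      simpa using hx
  refine ⟨_, fun h hh hI => hf ?_, isOpen_nbhd f hu, mem_nbhd_self hu⟩
  have hne : ∀ x, f.1 x ≠ 0 → h.1 x ≠ 0 := fun x hx h0 => by
    have := hh x
    rw [piecewise_apply_of_notMem hZ _ _ hx] at this
    simp only [h0, zero_sub, abs_neg, half_apply, abs_apply] at this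
    linarith [abs_nonneg (f.1 x)]
  have hd : ∀ x, (piecewise hZ 1 h).1 x ≠ 0 := fun x => by
    by_cases hx : f.1 x = 0
    · simp [piecewise_apply_of_mem hZ _ _ hx]
    · rw [piecewise_apply_of_notMem hZ _ _ hx]
      exact hne x hx
  -- The inverted function equals `h` off the zero set of `f`; on it both sides are `0`.
  have : f = f * inv (piecewise hZ 1 h) hd * h := by
    ext x
    by_cases hx : f.1 x = 0
    · simp [hx]
    · simp [piecewise_apply_of_notMem hZ _ _ hx, hne x hx]
  rw [SetLike.mem_coe, this]
  exact I.mul_mem_left _ hI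

/-- The ideal of functions vanishing on a neighbourhood of `x`. -/
def germIdeal (x : X) : Ideal (Cc X) where
  carrier := {f | ∀ᶠ y in nhds x, f.1 y = 0}
  add_mem' hf hg := by
    filter_upwards [hf, hg] with y h₁ h₂
    simp [h₁, h₂]
  zero_mem' := Filter.Eventually.of_forall fun _ => rfl
  smul_mem' c f hf := by
    filter_upwards [hf] with y h
    simp [h]

theorem mem_germIdeal {x : X} {f : Cc X} : f ∈ germIdeal x ↔ ∀ᶠ y in nhds x, f.1 y = 0 := Iff.rfl

theorem germIdeal_ne_top (x : X) : germIdeal x ≠ ⊤ := by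
  rw [Ideal.ne_top_iff_one, mem_germIdeal]
  exact fun h => one_ne_zero (α := ℝ) h.self_of_nhds

/-- Near `x` one has `|f| < u`, so resetting `f` to `0` on a small clopen set around `x` moves it by
less than `u` and lands in the ideal. -/
theorem mem_germIdeal_of_isClosed (hX : IsZeroDimensional X) {x : X}
    (hc : @IsClosed (Cc X) (mcTopology X) (germIdeal x : Set (Cc X))) {f : Cc X}
    (hf : f.1 x = 0) : f ∈ germIdeal x := by
  by_contra hmem
  obtain ⟨u, hu, hsub⟩ := exists_nbhd_subset_of_isOpen hc.isOpen_compl hmem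
  have hO : IsOpen {y | |f.1 y| < u.1 y} :=
    isOpen_lt (continuous_abs.comp f.1.continuous) u.1.continuous
  obtain ⟨W, hW, hxW, hWO⟩ := hX.exists_subset_of_mem_open
    (show x ∈ {y | |f.1 y| < u.1 y} by simpa [hf] using hu.2 x) hO
  have hW : IsClopen W := hW
  refine hsub (a := piecewise hW 0 f) (fun y => ?_) ?_
  · by_cases hy : y ∈ W
    · rw [piecewise_apply_of_mem hW _ _ hy]
      simpa using hWO hy
    · rw [piecewise_apply_of_notMem hW _ _ hy]
      simpa using hu.2 y
  · filter_upwards [hW.isOpen.mem_nhds hxW] with y hy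
    rw [piecewise_apply_of_mem hW _ _ hy]
    rfl

/-- A decreasing sequence of clopen sets has as intersection the zero set of a function in
`C_c(X)`. -/
theorem exists_zeroSet_eq_iInter {V : ℕ → Set X} (hV : ∀ n, IsClopen (V n)) (hanti : Antitone V) :
    ∃ f : Cc X, ∀ x, f.1 x = 0 ↔ ∀ n, x ∈ V n := by
  classical
  let φ : Set ℕ → ℝ := fun S => ∑' n, if n ∈ S then (0 : ℝ) else (1 / 2) ^ n
  let N : X → Set ℕ := fun x => {n | x ∈ V n}
  have hle : ∀ S : Set ℕ, ∀ n, ‖if n ∈ S then (0 : ℝ) else (1 / 2) ^ n‖ ≤ (1 / 2) ^ n := by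
    intro S n
    split_ifs <;> simp
  have hsum : ∀ S : Set ℕ, Summable fun n => if n ∈ S then (0 : ℝ) else (1 / 2) ^ n := fun S =>
    Summable.of_norm_bounded summable_geometric_two (hle S)
  have hcont : Continuous fun x => φ (N x) := by
    refine continuous_tsum (fun n => ?_) summable_geometric_two fun n x => hle (N x) n
    exact Continuous.if (by simp [N, (hV n).frontier_eq]) continuous_const continuous_const
  -- Countability of the range: as `V` decreases, `N x` is an initial segment of `ℕ` or all of it.
  have hN : ∀ x, N x ∈ insert Set.univ (Set.range fun n : ℕ => Set.Iio n) := by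
    intro x
    by_cases h : ∀ n, x ∈ V n
    · exact Or.inl (Set.eq_univ_of_forall h)
    · push Not at h
      refine Or.inr ⟨Nat.find h, Set.ext fun n => ?_⟩
      simp only [Set.mem_Iio, Nat.lt_find_iff, not_not, N, Set.mem_ofPred_eq]
      exact ⟨fun H => H n le_rfl, fun H m hm => hanti hm H⟩
  refine ⟨⟨⟨fun x => φ (N x), hcont⟩, ?_⟩, fun x => ?_⟩
  · refine (((Set.countable_range fun n : ℕ => Set.Iio n).insert Set.univ).image φ).mono ?_
    rintro _ ⟨x, rfl⟩
    exact ⟨N x, hN x, rfl⟩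
  · change φ (N x) = 0 ↔ _
    rw [← (hsum (N x)).hasSum_iff, hasSum_zero_iff_of_nonneg]
    · simp only [funext_iff, N, Set.mem_ofPred_eq, Pi.zero_apply, ite_eq_left_iff]
      refine forall_congr' fun n => ?_
      by_cases h : x ∈ V n <;> simp [h]
    · intro n
      split_ifs <;> positivity

theorem isPSpace_of_isClosed_germIdeal (hX : IsZeroDimensional X)
    (hc : ∀ x : X, @IsClosed (Cc X) (mcTopology X) (germIdeal x : Set (Cc X))) : IsPSpace X := by
  intro s hs
  obtain ⟨U, hU, rfl⟩ := isGδ_iff_eq_iInter_nat.1 hs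
  refine isOpen_iff_mem_nhds.2 fun x hx => ?_
  choose V hV hxV hVU using fun n =>
    hX.exists_subset_of_mem_open (Set.mem_iInter.1 hx n) (hU n)
  -- Finite intersections make the clopen sequence decreasing.
  obtain ⟨f, hf⟩ := exists_zeroSet_eq_iInter (V := fun n => ⋂ k ∈ Set.Iic n, V k)
    (fun n => (Set.finite_Iic n).isClopen_biInter fun k _ => hV k)
    (fun m n hmn => Set.biInter_subset_biInter_left (Set.Iic_subset_Iic.2 hmn))
  have hfx : f.1 x = 0 := (hf x).2 fun n => Set.mem_iInter₂.2 fun k _ => hxV k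
  filter_upwards [mem_germIdeal.1 (mem_germIdeal_of_isClosed hX (hc x) hfx)] with y hy
  exact Set.mem_iInter.2 fun n => hVU n (Set.mem_iInter₂.1 ((hf y).1 hy n) n (Set.mem_Iic.2 le_rfl))

end Cc

theorem theorem3p10 (X : Type*) [TopologicalSpace X] [T2Space X] (hX : IsZeroDimensional X) :
    IsPSpace X ↔ ∀ I : Ideal (Cc X), I ≠ ⊤ → @IsClosed (Cc X) (mcTopology X) (I : Set (Cc X)) :=
  ⟨fun hP I _ => Cc.isClosed_ideal_of_isPSpace hP I, fun h =>
    Cc.isPSpace_of_isClosed_germIdeal hX fun x => h _ (Cc.germIdeal_ne_top x)⟩
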